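/- Let $b,c\in\mathbb{R}$ and let the polynomials $H_m(z)$, $m\ge 0$, be defined by $H_0(z)=1$, $H_1(z)=-c$, $H_2(z)=-b+c^2$ and \[ H_m(z)+cH_{m-1}(z)+bH_{m-2}(z)+zH_{m-3}(z)=0,\qquad m\ge 3. \] Let $\mathcal{Z}(H_m)\subset\mathbb{C}$ be the set of zeros of $H_m$, with the convention that $\mathcal{Z}(H_m)=\emptyset$ if $H_m$ is the zero polynomial (so that the zeros of the zero polynomial count as real). Then all zeros of $H_m$ are real for every $m\ge 0$ if and only if one of the following two conditions holds: (i) $c=0$ and $b\ge 0$; (ii) $c\ne 0$ and $-1\le b/c^2\le 1/3$. Moreover, if $c=0$ and $b>0$, then the real points of $\bigcup_{m=0}^\infty\mathcal{Z}(H_m)$ are dense in $(-\infty,\infty)$. In case (ii), every point of the interval \[ c^3\cdot\left(-\infty,\ \frac{-2+9b/c^2-2\sqrt{(1-3b/c^2)^3}}{27}\right] \] is a limit of real points of $\bigcup_{m=0}^\infty\mathcal{Z}(H_m)$, that is, this union is dense on the interval (here $c^3\cdot I=\{c^3x : x\in I\}$). -/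

import Mathlib

open Polynomial

/-!
The polynomials `H m` are the coefficients of `1 / (1 + c t + b t² + z t³)`, that is, the complete
homogeneous symmetric polynomials in the roots `x₁, x₂, x₃` of `x³ + c x² + b x + z`. Write
`x₁, x₂ = exp (± i θ) / u` and `x₃ = ζ / u`. Then `closed_form` reads
`u ^ m * sin θ * (1 - 2 ζ cos θ + ζ²) * H m z
  = sin ((m + 1) θ) - ζ sin ((m + 2) θ) + ζ ^ (m + 2) sin θ`.

*Real zeros.* Suppose `z` runs over real values for which `x₁, x₂` are complex conjugate and
dominate, `|ζ| < 1`. At `θ = k π / (m + 2)` the right-hand side has sign `-(-1) ^ k`, so between two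
consecutive such angles `H m` has a zero (`IsRootArc.exists_root`). In the admissible range `θ` can
run over an open interval of length `π / 3` (`isRootArc_of_c_eq_zero`, `isRootArc_of_c_ne_zero`).
This yields at least `m / 3 - 1` distinct real zeros, while `H m` has degree at most `m / 3`; the
one zero which may be missing cannot be non-real because non-real zeros come in conjugate pairs.
The zeros are dense in the image of the arc, and that image is computed by the intermediate value
theorem.

*Non-real zeros.* Outside the admissible range there is an angle `θ₀` for which the equation for
`u` has non-real roots while still `|ζ| < 1` (`exists_cos_sq`). The roots `x₁, x₂` then have equal
modulus, are dominant, and belong to a non-real `z`. Such a `z` is a limit of zeros of the `H m`, an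
instance of the Beraha-Kahane-Weiss theorem, proved here from the quantitative open mapping theorem
for complex angles near `θ₀` (`exists_sin_combination_eq_zero`).
-/

/-! ### A closed form for the recurrence -/

/-- Here `s` is a Chebyshev sequence such as `s n = sin (n θ)` with `C = cos θ`. The hypotheses on
`u` and `ζ` say that `1 + c t + b t² + z t³ = (1 - 2 C (t/u) + (t/u)²) (1 - ζ (t/u))`, so both sides
solve the same recurrence. -/
theorem closed_form {R : Type*} [CommRing R] {b c z u C ζ : R} {h s : ℕ → R}
    (h0 : h 0 = 1) (h1 : h 1 = -c) (h2 : h 2 = -b + c ^ 2)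
    (hrec : ∀ m, h (m + 3) + c * h (m + 2) + b * h (m + 1) + z * h m = 0)
    (s0 : s 0 = 0) (hs : ∀ n, s (n + 2) = 2 * C * s (n + 1) - s n)
    (hc : c * u = -(2 * C + ζ)) (hb : b * u ^ 2 = 1 + 2 * ζ * C) (hz : z * u ^ 3 = -ζ) (m : ℕ) :
    u ^ m * (s 1 * (1 - 2 * ζ * C + ζ ^ 2)) * h m =
      s (m + 1) - ζ * s (m + 2) + ζ ^ (m + 2) * s 1 := by
  have s2 : s 2 = 2 * C * s 1 := by rw [hs 0, s0]; ring
  have s3 : s 3 = (4 * C ^ 2 - 1) * s 1 := by rw [hs 1, s2]; ring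
  have s4 : s 4 = (8 * C ^ 3 - 4 * C) * s 1 := by rw [hs 2, s2, s3]; ring
  have key : ∀ m, (∀ i ∈ ({m, m + 1, m + 2} : Finset ℕ),
      u ^ i * (s 1 * (1 - 2 * ζ * C + ζ ^ 2)) * h i =
        s (i + 1) - ζ * s (i + 2) + ζ ^ (i + 2) * s 1) := by
    intro m
    induction m with
    | zero =>
      intro i hi
      simp only [Finset.mem_insert, Finset.mem_singleton] at hi
      rcases hi with rfl | rfl | rfl
      · simp only [zero_add, h0, s2]; ring
      · simp only [zero_add, Nat.reduceAdd, h1, s2, s3]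
        linear_combination (-(s 1 * (1 - 2 * ζ * C + ζ ^ 2))) * hc
      · simp only [zero_add, Nat.reduceAdd, h2, s3, s4]
        linear_combination (s 1 * (1 - 2 * ζ * C + ζ ^ 2)) *
          ((c * u - (2 * C + ζ)) * hc - hb)
    | succ m ih =>
      simp only [Finset.mem_insert, Finset.mem_singleton, forall_eq_or_imp, forall_eq] at ih ⊢
      obtain ⟨e0, e1, e2⟩ := ih
      refine ⟨e1, e2, ?_⟩
      have r2 := hs (m + 1)
      have r3 := hs (m + 2)
      have r4 := hs (m + 3)
      simp only [add_assoc, Nat.reduceAdd] at *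
      linear_combination (u ^ (m + 3) * (s 1 * (1 - 2 * ζ * C + ζ ^ 2))) * hrec m
        - (u ^ (m + 2) * (s 1 * (1 - 2 * ζ * C + ζ ^ 2)) * h (m + 2)) * hc
        - (u ^ (m + 1) * (s 1 * (1 - 2 * ζ * C + ζ ^ 2)) * h (m + 1)) * hb
        - (u ^ m * (s 1 * (1 - 2 * ζ * C + ζ ^ 2)) * h m) * hz
        + (2 * C + ζ) * e2 - (1 + 2 * ζ * C) * e1 + ζ * e0 + ζ * r4 - (1 + ζ ^ 2) * r3
        + ζ * r2
  exact key m m (by simp)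

/-! ### Real-rootedness from nearly enough real zeros -/

/-- Non-real zeros of a real polynomial come in conjugate pairs, so a polynomial of degree at most
`n` with `n - 1` distinct real zeros has no non-real zero. -/
theorem im_eq_zero_of_card_roots {p : ℝ[X]} {n : ℕ} (hn : p.natDegree ≤ n) {S : Finset ℝ}
    (hS : ∀ x ∈ S, p.eval x = 0) (hcard : n ≤ S.card + 1) {z : ℂ} (hz : z ∈ p.rootSet ℂ) :
    z.im = 0 := by
  by_contra him
  obtain ⟨hp, hz0⟩ := mem_rootSet'.1 hz
  have hconj : aeval ((starRingEnd ℂ) z) p = 0 := by rw [aeval_conj, hz0, map_zero]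
  set T : Finset ℂ := insert z (insert ((starRingEnd ℂ) z) (S.image (fun x : ℝ => (x : ℂ))))
    with hT
  have hne : z ≠ (starRingEnd ℂ) z := fun h => him (Complex.conj_eq_iff_im.1 h.symm)
  have hcT : T.card = S.card + 2 := by
    rw [hT, Finset.card_insert_of_notMem, Finset.card_insert_of_notMem,
      Finset.card_image_of_injective _ Complex.ofReal_injective]
    · rw [Finset.mem_image]
      rintro ⟨x, -, hx⟩
      apply him
      have := congrArg Complex.im hx
      simpa using this.symm
    · rw [Finset.mem_insert, Finset.mem_image]
      rintro (h | ⟨x, -, hx⟩)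
      · exact hne h
      · exact him (by rw [← hx, Complex.ofReal_im])
  have hsub : T.val ⊆ (p.map (algebraMap ℝ ℂ)).roots := by
    intro w hw
    rw [mem_roots hp, IsRoot.def, eval_map_algebraMap]
    have hw : w ∈ T := hw
    rw [hT, Finset.mem_insert, Finset.mem_insert, Finset.mem_image] at hw
    rcases hw with rfl | rfl | ⟨x, hx, rfl⟩
    · exact hz0
    · exact hconj
    · have := aeval_algebraMap_apply ℂ x p
      rw [coe_aeval_eq_eval, hS x hx, map_zero] at this
      exact this
  have h3 := card_le_degree_of_subset_roots hsub
  rw [natDegree_map] at h3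
  omega

/-! ### Degree -/

theorem natDegree_le_div_three {b c : ℝ} {H : ℕ → ℝ[X]}
    (h0 : H 0 = 1) (h1 : H 1 = C (-c)) (h2 : H 2 = C (-b + c ^ 2))
    (hrec : ∀ m, H (m + 3) + C c * H (m + 2) + C b * H (m + 1) + X * H m = 0) (m : ℕ) :
    (H m).natDegree ≤ m / 3 := by
  induction m using Nat.strong_induction_on with
  | _ m ih =>
    match m, ih with
    | 0, _ => simp [h0]
    | 1, _ => simp [h1]
    | 2, _ => rw [h2]; exact (natDegree_C _).le
    | m + 3, ih =>
      have e : H (m + 3) = -(C c * H (m + 2) + C b * H (m + 1) + X * H m) := by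
        linear_combination hrec m
      have i2 := ih (m + 2) (by omega)
      have i1 := ih (m + 1) (by omega)
      have i0 := ih m (by omega)
      rw [e, natDegree_neg]
      refine natDegree_add_le_of_degree_le (natDegree_add_le_of_degree_le ?_ ?_) ?_
      · exact (natDegree_C_mul_le _ _).trans (by omega)
      · exact (natDegree_C_mul_le _ _).trans (by omega)
      · refine natDegree_mul_le.trans ?_
        rw [natDegree_X]; omega

/-! ### Arcs of parameters with two dominant complex conjugate roots -/

/-- A curve of factorizations
`1 + c t + b t² + z t³ = (1 - 2 cos θ (t / u) + (t / u)²) (1 - ζ (t / u))`, with `z = -ζ / u³`,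
parametrized by `θ` in an open subinterval of `(0, π)` of length `π / 3`, along which the two
conjugate factors dominate: `|ζ| < 1`. The scale `u` may be negative but keeps its sign. -/
structure IsRootArc (b c α : ℝ) (u ζ : ℝ → ℝ) : Prop where
  nonneg : 0 ≤ α
  le_pi : α + Real.pi / 3 ≤ Real.pi
  contU : ContinuousOn u (Set.Ioo α (α + Real.pi / 3))
  contZ : ContinuousOn ζ (Set.Ioo α (α + Real.pi / 3))
  abs_lt : ∀ θ ∈ Set.Ioo α (α + Real.pi / 3), |ζ θ| < 1
  sign_u : ∀ θ ∈ Set.Ioo α (α + Real.pi / 3), ∀ θ' ∈ Set.Ioo α (α + Real.pi / 3), 0 < u θ * u θ'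
  linear : ∀ θ ∈ Set.Ioo α (α + Real.pi / 3), c * u θ = -(2 * Real.cos θ + ζ θ)
  quadratic : ∀ θ ∈ Set.Ioo α (α + Real.pi / 3), b * u θ ^ 2 = 1 + 2 * ζ θ * Real.cos θ

namespace IsRootArc

variable {b c α : ℝ} {u ζ : ℝ → ℝ}

theorem ne_zero (h : IsRootArc b c α u ζ) {θ : ℝ} (hθ : θ ∈ Set.Ioo α (α + Real.pi / 3)) :
    u θ ≠ 0 := fun h0 => by
  have := h.sign_u θ hθ θ hθ
  simp [h0] at this

theorem sin_pos (h : IsRootArc b c α u ζ) {θ : ℝ} (hθ : θ ∈ Set.Ioo α (α + Real.pi / 3)) :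
    0 < Real.sin θ :=
  Real.sin_pos_of_pos_of_lt_pi (h.nonneg.trans_lt hθ.1) (hθ.2.trans_le h.le_pi)

theorem cofactor_pos (h : IsRootArc b c α u ζ) {θ : ℝ} (hθ : θ ∈ Set.Ioo α (α + Real.pi / 3)) :
    0 < Real.sin θ * (1 - 2 * ζ θ * Real.cos θ + ζ θ ^ 2) := by
  have hs := h.sin_pos hθ
  refine mul_pos hs ?_
  nlinarith [sq_nonneg (ζ θ - Real.cos θ), Real.sin_sq_add_cos_sq θ, mul_pos hs hs]

theorem continuousOn_z (h : IsRootArc b c α u ζ) :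
    ContinuousOn (fun θ => -ζ θ / u θ ^ 3) (Set.Ioo α (α + Real.pi / 3)) :=
  h.contZ.neg.div (h.contU.pow 3) fun _ hθ => pow_ne_zero 3 (h.ne_zero hθ)

/-- The number `ζ / u` is the only real root of `x³ + c x² + b x + z`, so `z` determines it, and
then it determines the complex conjugate pair of roots. -/
theorem injOn_z (h : IsRootArc b c α u ζ) :
    Set.InjOn (fun θ => -ζ θ / u θ ^ 3) (Set.Ioo α (α + Real.pi / 3)) := by
  intro θ hθ φ hφ heq
  have hu := h.ne_zero hθ
  have hv := h.ne_zero hφ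
  have hsv := h.sin_pos hφ
  have huv := h.sign_u θ hθ φ hφ
  have l1 := h.linear θ hθ
  have l2 := h.linear φ hφ
  have q1 := h.quadratic θ hθ
  have q2 := h.quadratic φ hφ
  have pyth := Real.sin_sq_add_cos_sq φ
  have hinj := Real.injOn_cos (x₁ := θ) ⟨(h.nonneg.trans_lt hθ.1).le, (hθ.2.trans_le h.le_pi).le⟩
    (x₂ := φ) ⟨(h.nonneg.trans_lt hφ.1).le, (hφ.2.trans_le h.le_pi).le⟩
  simp only at heq
  generalize Real.cos θ = C, Real.cos φ = D, Real.sin φ = s, u θ = u, u φ = v, ζ θ = x,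
    ζ φ = y at *
  rw [div_eq_div_iff (pow_ne_zero 3 hu) (pow_ne_zero 3 hv)] at heq
  -- `x / u` is a root of the cubic factored by means of `φ`
  have hroot : (x * v - y * u) * ((x * v - D * u) ^ 2 + (s * u) ^ 2) = 0 := by
    linear_combination v ^ 3 * x ^ 2 * l1 + v ^ 3 * x * q1 - x ^ 2 * v ^ 2 * u * l2 -
      x * v * u ^ 2 * q2 - heq + (x * v - y * u) * u ^ 2 * pyth
  have hpos : 0 < (x * v - D * u) ^ 2 + (s * u) ^ 2 := by positivity
  have hxy : x * v = y * u := by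
    rcases mul_eq_zero.1 hroot with h | h
    · linarith
    · exact absurd h hpos.ne'
  have hCD : C * v = D * u := by linear_combination (v * l1 - u * l2 - hxy) / 2
  have huv2 : (u - v) * (u + v) = 0 := by
    linear_combination v ^ 2 * q1 - u ^ 2 * q2 + 2 * C * v * hxy + 2 * y * u * hCD
  have hne : u + v ≠ 0 := fun h0 => by
    have : v = -u := by linarith
    rw [this] at huv
    nlinarith [sq_nonneg u]
  have huv' : u = v := by
    rcases mul_eq_zero.1 huv2 with h | h
    · linarith
    · exact absurd h hne
  apply hinj
  rw [huv'] at hCD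
  exact mul_right_cancel₀ hv hCD

variable {H : ℕ → ℝ[X]}

theorem eval_closed_form (h : IsRootArc b c α u ζ)
    (h0 : H 0 = 1) (h1 : H 1 = C (-c)) (h2 : H 2 = C (-b + c ^ 2))
    (hrec : ∀ m, H (m + 3) + C c * H (m + 2) + C b * H (m + 1) + X * H m = 0)
    {θ : ℝ} (hθ : θ ∈ Set.Ioo α (α + Real.pi / 3)) (m : ℕ) :
    u θ ^ m * (Real.sin θ * (1 - 2 * ζ θ * Real.cos θ + ζ θ ^ 2)) *
        (H m).eval (-ζ θ / u θ ^ 3) =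
      Real.sin ((m + 1) * θ) - ζ θ * Real.sin ((m + 2) * θ) + ζ θ ^ (m + 2) * Real.sin θ := by
  have hu := h.ne_zero hθ
  have := closed_form (h := fun m => (H m).eval (-ζ θ / u θ ^ 3)) (z := -ζ θ / u θ ^ 3)
    (s := fun n : ℕ => Real.sin (n * θ)) (C := Real.cos θ) (by simp [h0]) (by simp [h1])
    (by rw [h2, eval_C])
    (fun m => by simpa using congrArg (eval (-ζ θ / u θ ^ 3)) (hrec m)) (by simp)
    (fun n => by
      have e1 : ((n + 2 : ℕ) : ℝ) * θ = (n + 1 : ℕ) * θ + θ := by push_cast; ring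
      have e2 : (n : ℝ) * θ = (n + 1 : ℕ) * θ - θ := by push_cast; ring
      simp only [e1, e2, Real.sin_add, Real.sin_sub]; ring)
    (h.linear θ hθ) (h.quadratic θ hθ) (by field_simp) m
  simpa using this

/-- At the zeros `k π / (m + 2)` of `sin ((m + 2) θ)` the closed form reduces to
`sin θ * (ζ ^ (m + 2) - (-1) ^ k)`, so the sign of `H m` alternates with `k`. -/
theorem eval_sign (h : IsRootArc b c α u ζ)
    (h0 : H 0 = 1) (h1 : H 1 = C (-c)) (h2 : H 2 = C (-b + c ^ 2))
    (hrec : ∀ m, H (m + 3) + C c * H (m + 2) + C b * H (m + 1) + X * H m = 0)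
    {m k : ℕ} {θ : ℝ} (hk : ((m : ℝ) + 2) * θ = k * Real.pi)
    (hθ : θ ∈ Set.Ioo α (α + Real.pi / 3)) :
    (-1) ^ k * (u θ ^ m * (H m).eval (-ζ θ / u θ ^ 3)) < 0 := by
  have hs := h.sin_pos hθ
  have key := h.eval_closed_form h0 h1 h2 hrec hθ m
  have hz : |ζ θ ^ (m + 2)| < 1 := by
    rw [abs_pow]
    exact pow_lt_one₀ (abs_nonneg _) (h.abs_lt θ hθ) (by omega)
  obtain ⟨hz1, hz2⟩ := _root_.abs_lt.1 hz
  have e1 : Real.sin ((m + 2) * θ) = 0 := by rw [hk, Real.sin_nat_mul_pi]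
  have e2 : Real.sin ((m + 1) * θ) = -((-1) ^ k * Real.sin θ) := by
    have : ((m : ℝ) + 1) * θ = k * Real.pi - θ := by linear_combination hk
    rw [this, Real.sin_nat_mul_pi_sub]
  rw [e1, e2] at key
  have hc := h.cofactor_pos hθ
  set S := Real.sin θ * (1 - 2 * ζ θ * Real.cos θ + ζ θ ^ 2)
  set E := (H m).eval (-ζ θ / u θ ^ 3)
  have hprod : S * ((-1) ^ k * (u θ ^ m * E)) < 0 := by
    have e : S * ((-1) ^ k * (u θ ^ m * E)) = (-1) ^ k * (u θ ^ m * S * E) := by ring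
    rw [e, key]
    rcases neg_one_pow_eq_or ℝ k with hk | hk <;> rw [hk] <;> nlinarith
  exact (pos_iff_neg_of_mul_neg hprod).1 hc

/-- Between two consecutive parameters `k π / (m + 2)` lies a zero of `H m`. -/
theorem exists_root (h : IsRootArc b c α u ζ)
    (h0 : H 0 = 1) (h1 : H 1 = C (-c)) (h2 : H 2 = C (-b + c ^ 2))
    (hrec : ∀ m, H (m + 3) + C c * H (m + 2) + C b * H (m + 1) + X * H m = 0)
    {m k : ℕ} (hk : α < k * Real.pi / (m + 2))
    (hk' : ((k + 1 : ℕ) : ℝ) * Real.pi / (m + 2) < α + Real.pi / 3) :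
    H m ≠ 0 ∧ ∃ θ ∈ Set.Ioo (k * Real.pi / (m + 2)) (((k + 1 : ℕ) : ℝ) * Real.pi / (m + 2)),
      (H m).eval (-ζ θ / u θ ^ 3) = 0 := by
  have hm : (0 : ℝ) < m + 2 := by positivity
  have hlt : (k : ℝ) * Real.pi / (m + 2) < ((k + 1 : ℕ) : ℝ) * Real.pi / (m + 2) := by
    gcongr; simp
  set θ₁ := (k : ℝ) * Real.pi / (m + 2) with hθ₁
  set θ₂ := ((k + 1 : ℕ) : ℝ) * Real.pi / (m + 2) with hθ₂
  have hsub : Set.Icc θ₁ θ₂ ⊆ Set.Ioo α (α + Real.pi / 3) :=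
    fun θ hθ => ⟨hk.trans_le hθ.1, hθ.2.trans_lt hk'⟩
  have m1 := hsub (Set.left_mem_Icc.2 hlt.le)
  have m2 := hsub (Set.right_mem_Icc.2 hlt.le)
  have s1 := h.eval_sign h0 h1 h2 hrec (m := m) (k := k) (θ := θ₁)
    (by rw [hθ₁]; field_simp) m1
  have s2 := h.eval_sign h0 h1 h2 hrec (m := m) (k := k + 1) (θ := θ₂)
    (by rw [hθ₂]; field_simp) m2
  refine ⟨fun hz => by simp [hz] at s1, ?_⟩
  set f : ℝ → ℝ := fun θ => (-1) ^ k * (u θ ^ m * (H m).eval (-ζ θ / u θ ^ 3)) with hf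
  have hcont : ContinuousOn f (Set.Icc θ₁ θ₂) := by
    refine continuousOn_const.mul (((h.contU.mono hsub).pow m).mul ?_)
    exact (H m).continuous.comp_continuousOn (h.continuousOn_z.mono hsub)
  have s2' : 0 < f θ₂ := by
    rw [hf]
    rw [pow_succ] at s2
    simp only
    linarith
  obtain ⟨θ, hθ, hfθ⟩ := intermediate_value_Ioo hlt.le hcont ⟨s1, s2'⟩
  refine ⟨θ, hθ, ?_⟩
  have hu := h.ne_zero (hsub (Set.Ioo_subset_Icc_self hθ))
  simpa [hf, hu] using hfθ

/-- An open interval of length `(m + 2) / 3` contains at least `m / 3` integers, which gives enough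
sign changes for `H m` to be real-rooted. -/
theorem im_eq_zero (h : IsRootArc b c α u ζ)
    (h0 : H 0 = 1) (h1 : H 1 = C (-c)) (h2 : H 2 = C (-b + c ^ 2))
    (hrec : ∀ m, H (m + 3) + C c * H (m + 2) + C b * H (m + 1) + X * H m = 0)
    (m : ℕ) {z : ℂ} (hz : z ∈ (H m).rootSet ℂ) : z.im = 0 := by
  have hm : (0 : ℝ) < m + 2 := by positivity
  have hpi := Real.pi_pos
  set k₀ := ⌊α * (m + 2) / Real.pi⌋₊ + 1 with hk₀
  have hk₀_lt : α * (m + 2) / Real.pi < k₀ := by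
    rw [hk₀]; push_cast; exact Nat.lt_floor_add_one _
  have hk₀_le : (k₀ : ℝ) ≤ α * (m + 2) / Real.pi + 1 := by
    rw [hk₀]; push_cast
    have := Nat.floor_le (a := α * (m + 2) / Real.pi) (by have := h.nonneg; positivity)
    linarith
  have lower : ∀ j : ℕ, α < ((k₀ + j : ℕ) : ℝ) * Real.pi / (m + 2) := by
    intro j
    rw [lt_div_iff₀ hm, ← div_lt_iff₀ hpi]
    push_cast
    have : (0 : ℝ) ≤ j := by positivity
    linarith
  have upper : ∀ j : ℕ, j < m / 3 - 1 →
      ((k₀ + j + 1 : ℕ) : ℝ) * Real.pi / (m + 2) < α + Real.pi / 3 := by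
    intro j hj
    have hj' : 3 * ((j : ℝ) + 2) ≤ m := by
      have : 3 * (j + 2) ≤ m := by omega
      exact_mod_cast this
    rw [div_lt_iff₀ hm, ← lt_div_iff₀ hpi]
    have e : (α + Real.pi / 3) * (m + 2) / Real.pi = α * (m + 2) / Real.pi + (m + 2) / 3 := by
      field_simp
    rw [e]
    push_cast
    linarith
  choose! t ht htz using fun j hj =>
    (h.exists_root h0 h1 h2 hrec (m := m) (lower j) (upper j hj)).2
  have mem : ∀ j, j < m / 3 - 1 → t j ∈ Set.Ioo α (α + Real.pi / 3) := fun j hj =>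
    ⟨(lower j).trans (ht j hj).1, (ht j hj).2.trans (upper j hj)⟩
  have mono : ∀ i j, i < j → j < m / 3 - 1 → t i < t j := by
    intro i j hij hj
    refine ((ht i (hij.trans hj)).2.trans_le ?_).trans (ht j hj).1
    have : k₀ + i + 1 ≤ k₀ + j := by omega
    gcongr
  refine im_eq_zero_of_card_roots (natDegree_le_div_three h0 h1 h2 hrec m)
    (S := (Finset.range (m / 3 - 1)).image fun j => -ζ (t j) / u (t j) ^ 3) ?_ ?_ hz
  · intro x hx
    obtain ⟨j, hj, rfl⟩ := Finset.mem_image.1 hx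
    exact htz j (Finset.mem_range.1 hj)
  · rw [Finset.card_image_of_injOn, Finset.card_range]
    · omega
    · intro i hi j hj hij
      have hi : i < m / 3 - 1 := by simpa using hi
      have hj : j < m / 3 - 1 := by simpa using hj
      have := h.injOn_z (mem i hi) (mem j hj) hij
      rcases lt_trichotomy i j with hlt | heq | hlt
      · exact absurd this (mono i j hlt hj).ne
      · exact heq
      · exact absurd this (mono j i hlt hi).ne'

theorem mem_closure (h : IsRootArc b c α u ζ)
    (h0 : H 0 = 1) (h1 : H 1 = C (-c)) (h2 : H 2 = C (-b + c ^ 2))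
    (hrec : ∀ m, H (m + 3) + C c * H (m + 2) + C b * H (m + 1) + X * H m = 0)
    {θ : ℝ} (hθ : θ ∈ Set.Ioo α (α + Real.pi / 3)) :
    -ζ θ / u θ ^ 3 ∈ closure {x : ℝ | (x : ℂ) ∈ ⋃ m, (H m).rootSet ℂ} := by
  rw [Metric.mem_closure_iff]
  intro ε hε
  have hpi := Real.pi_pos
  have hnhds : Set.Ioo α (α + Real.pi / 3) ∈ nhds θ := isOpen_Ioo.mem_nhds hθ
  have hcont := (h.continuousOn_z.continuousAt hnhds).eventually (Metric.ball_mem_nhds _ hε)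
  obtain ⟨δ, hδ, hball⟩ := Metric.mem_nhds_iff.1 (Filter.inter_mem hnhds hcont)
  obtain ⟨m, hm⟩ := exists_nat_gt (Real.pi / δ)
  have hm2 : (0 : ℝ) < m + 2 := by positivity
  have hθ0 : 0 < θ := h.nonneg.trans_lt hθ.1
  have hstep : Real.pi / (m + 2) < δ := by
    rw [div_lt_iff₀ hm2]
    rw [div_lt_iff₀ hδ] at hm
    nlinarith
  set k := ⌊θ * (m + 2) / Real.pi⌋₊
  have hk1 : (k : ℝ) * Real.pi / (m + 2) ≤ θ := by
    rw [div_le_iff₀ hm2, ← le_div_iff₀ hpi]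
    exact Nat.floor_le (by positivity)
  have hk2 : θ < ((k + 1 : ℕ) : ℝ) * Real.pi / (m + 2) := by
    rw [lt_div_iff₀ hm2, ← div_lt_iff₀ hpi]
    push_cast
    exact Nat.lt_floor_add_one _
  have hkk : ((k + 1 : ℕ) : ℝ) * Real.pi / (m + 2) =
      k * Real.pi / (m + 2) + Real.pi / (m + 2) := by push_cast; ring
  have near : ∀ φ ∈ Set.Icc (k * Real.pi / (m + 2)) (((k + 1 : ℕ) : ℝ) * Real.pi / (m + 2)),
      φ ∈ Metric.ball θ δ := by
    intro φ hφ
    rw [Metric.mem_ball, Real.dist_eq, _root_.abs_lt]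
    constructor <;> linarith [hφ.1, hφ.2]
  obtain ⟨hne, φ, hφ, hz⟩ := h.exists_root h0 h1 h2 hrec (m := m) (k := k)
    (hball (near _ (Set.left_mem_Icc.2 (hk1.trans hk2.le)))).1.1
    (hball (near _ (Set.right_mem_Icc.2 (hk1.trans hk2.le)))).1.2
  refine ⟨-ζ φ / u φ ^ 3, Set.mem_iUnion.2 ⟨m, ?_⟩, ?_⟩
  · rw [mem_rootSet]
    refine ⟨hne, ?_⟩
    have := aeval_algebraMap_apply ℂ (-ζ φ / u φ ^ 3) (H m)
    rw [coe_aeval_eq_eval, hz, map_zero] at this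
    exact this
  · have := (hball (near φ (Set.Ioo_subset_Icc_self hφ))).2
    rw [dist_comm]
    exact this

end IsRootArc

/-! ### The two families of arcs -/

theorem cos_lt_half {θ : ℝ} (h1 : Real.pi / 3 < θ) (h2 : θ ≤ Real.pi) : Real.cos θ < 1 / 2 := by
  rw [← Real.cos_pi_div_three]
  exact Real.cos_lt_cos_of_nonneg_of_le_pi (by positivity) h2 h1

theorem half_lt_cos {θ : ℝ} (h1 : 0 ≤ θ) (h2 : θ < Real.pi / 3) : 1 / 2 < Real.cos θ := by
  rw [← Real.cos_pi_div_three]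
  exact Real.cos_lt_cos_of_nonneg_of_le_pi h1 (by linarith [Real.pi_pos]) h2

theorem abs_cos_lt_half {θ : ℝ} (hθ : θ ∈ Set.Ioo (Real.pi / 3) (Real.pi / 3 + Real.pi / 3)) :
    -(1 / 2) < Real.cos θ ∧ Real.cos θ < 1 / 2 := by
  have := Real.pi_pos
  refine ⟨?_, cos_lt_half hθ.1 (by linarith [hθ.2])⟩
  have := cos_lt_half (θ := Real.pi - θ) (by linarith [hθ.2]) (by linarith [hθ.1])
  rw [Real.cos_pi_sub] at this
  linarith

/-- For `c = 0` the third root is minus the sum of the conjugate pair, so `ζ = -2 cos θ`. -/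
theorem isRootArc_of_c_eq_zero {b : ℝ} (hb : 0 < b) :
    IsRootArc b 0 (Real.pi / 3) (fun θ => √((1 - 4 * Real.cos θ ^ 2) / b))
      (fun θ => -2 * Real.cos θ) := by
  have hpi := Real.pi_pos
  have hpos : ∀ θ ∈ Set.Ioo (Real.pi / 3) (Real.pi / 3 + Real.pi / 3),
      0 < (1 - 4 * Real.cos θ ^ 2) / b := by
    intro θ hθ
    obtain ⟨h1, h2⟩ := abs_cos_lt_half hθ
    exact div_pos (by nlinarith) hb
  exact
    { nonneg := by positivity
      le_pi := by linarith
      contU := by fun_prop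
      contZ := by fun_prop
      abs_lt := fun θ hθ => by
        obtain ⟨h1, h2⟩ := abs_cos_lt_half hθ
        rw [abs_lt]; constructor <;> linarith
      sign_u := fun θ hθ θ' hθ' =>
        mul_pos (Real.sqrt_pos.2 (hpos θ hθ)) (Real.sqrt_pos.2 (hpos θ' hθ'))
      linear := fun θ _ => by ring
      quadratic := fun θ hθ => by
        rw [Real.sq_sqrt (hpos θ hθ).le, mul_div_cancel₀ _ hb.ne']; ring }

theorem exists_z_eq_of_c_eq_zero {b : ℝ} (hb : 0 < b) (y : ℝ) :
    ∃ θ ∈ Set.Ioo (Real.pi / 3) (Real.pi / 3 + Real.pi / 3),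
      -(-2 * Real.cos θ) / √((1 - 4 * Real.cos θ ^ 2) / b) ^ 3 = y := by
  have hpi := Real.pi_pos
  have hcont : ContinuousOn
      (fun θ => y * √((1 - 4 * Real.cos θ ^ 2) / b) ^ 3 + -2 * Real.cos θ)
      (Set.Icc (Real.pi / 3) (Real.pi / 3 + Real.pi / 3)) := by fun_prop
  have hcos : Real.cos (Real.pi / 3 + Real.pi / 3) = -(1 / 2) := by
    rw [← Real.cos_pi_div_three, ← Real.cos_pi_sub]; congr 1; ring
  obtain ⟨θ, hθ, h0⟩ := intermediate_value_Ioo (by linarith) hcont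
    (show (0 : ℝ) ∈ _ by
      simp only [hcos, Real.cos_pi_div_three]
      norm_num)
  have hu := (isRootArc_of_c_eq_zero hb).ne_zero hθ
  refine ⟨θ, hθ, ?_⟩
  simp only at h0 hu
  rw [div_eq_iff (pow_ne_zero 3 hu)]
  linarith

/-- The value `-c u` of the normalized scale for `c ≠ 0` and `a = b / c²`. It is the root
`(cos θ - √(cos² θ (1 - 4 a) + a)) / a` of `a v² - 2 v cos θ + 4 cos² θ - 1`, in a form which also
makes sense for `a = 0`. -/
noncomputable def arcScale (a θ : ℝ) : ℝ :=
  (4 * Real.cos θ ^ 2 - 1) / (Real.cos θ + √(Real.cos θ ^ 2 * (1 - 4 * a) + a))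

theorem arcScale_mul {a θ : ℝ} (hθ : 0 < Real.cos θ) :
    arcScale a θ * (Real.cos θ + √(Real.cos θ ^ 2 * (1 - 4 * a) + a)) =
      4 * Real.cos θ ^ 2 - 1 :=
  div_mul_cancel₀ _ (by positivity)

theorem continuousOn_arcScale (a : ℝ) {s : Set ℝ} (hs : ∀ θ ∈ s, 0 < Real.cos θ) :
    ContinuousOn (arcScale a) s := by
  unfold arcScale
  refine ContinuousOn.div (by fun_prop) (by fun_prop) fun θ hθ => ?_
  have := hs θ hθ
  positivity

/-- For `c ≠ 0` the bound `b / c² ≤ 1 / 3` keeps `u` real on the whole arc, and `-1 ≤ b / c²`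
keeps `ζ` above `-1`. -/
theorem isRootArc_of_c_ne_zero {b c : ℝ} (hc : c ≠ 0) (h1 : -1 ≤ b / c ^ 2)
    (h2 : b / c ^ 2 ≤ 1 / 3) :
    IsRootArc b c 0 (fun θ => -arcScale (b / c ^ 2) θ / c)
      (fun θ => arcScale (b / c ^ 2) θ - 2 * Real.cos θ) := by
  have hpi := Real.pi_pos
  obtain ⟨a, ha⟩ : ∃ a, b / c ^ 2 = a := ⟨_, rfl⟩
  have hb : b = a * c ^ 2 := by rw [← ha]; field_simp
  rw [ha] at h1 h2 ⊢
  have hcos : ∀ θ ∈ Set.Ioo (0 : ℝ) (0 + Real.pi / 3), 1 / 2 < Real.cos θ ∧ Real.cos θ < 1 := by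
    intro θ hθ
    refine ⟨half_lt_cos hθ.1.le (by linarith [hθ.2]), ?_⟩
    rw [← Real.cos_zero]
    exact Real.cos_lt_cos_of_nonneg_of_le_pi le_rfl (by linarith [hθ.2]) hθ.1
  have hcos0 : ∀ θ ∈ Set.Ioo (0 : ℝ) (0 + Real.pi / 3), 0 < Real.cos θ :=
    fun θ hθ => by linarith [(hcos θ hθ).1]
  have hpos : ∀ θ ∈ Set.Ioo (0 : ℝ) (0 + Real.pi / 3), 0 < arcScale a θ := by
    intro θ hθ
    have := hcos0 θ hθ
    exact div_pos (by nlinarith [(hcos θ hθ).1]) (by positivity)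
  have hcont := continuousOn_arcScale a hcos0
  refine
    { nonneg := le_rfl
      le_pi := by linarith
      contU := hcont.neg.div_const c
      contZ := hcont.sub (by fun_prop)
      abs_lt := fun θ hθ => ?_
      sign_u := fun θ hθ θ' hθ' => ?_
      linear := fun θ _ => by field_simp; ring
      quadratic := fun θ hθ => ?_ }
  · have hv := arcScale_mul (a := a) (hcos0 θ hθ)
    obtain ⟨hC1, hC2⟩ := hcos θ hθ
    have hw := Real.sqrt_nonneg (Real.cos θ ^ 2 * (1 - 4 * a) + a)
    have hw' : √(Real.cos θ ^ 2 * (1 - 4 * a) + a) < Real.cos θ + 1 := by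
      rw [Real.sqrt_lt' (by linarith)]
      nlinarith [mul_nonneg (by linarith : 0 ≤ a + 1)
        (by nlinarith : 0 ≤ 4 * Real.cos θ ^ 2 - 1)]
    generalize √(Real.cos θ ^ 2 * (1 - 4 * a) + a) = w at *
    generalize arcScale a θ = v, Real.cos θ = C at *
    rw [abs_lt]
    have hCw : 0 < C + w := by linarith
    constructor
    · have : 0 < (v - (2 * C - 1)) * (C + w) := by nlinarith
      linarith [pos_of_mul_pos_left this hCw.le]
    · have : 0 < (2 * C + 1 - v) * (C + w) := by nlinarith
      linarith [pos_of_mul_pos_left this hCw.le]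
  · have e : -arcScale a θ / c * (-arcScale a θ' / c) = arcScale a θ * arcScale a θ' / c ^ 2 := by
      field_simp
    rw [e]
    exact div_pos (mul_pos (hpos θ hθ) (hpos θ' hθ')) (by positivity)
  · have hv := arcScale_mul (a := a) (hcos0 θ hθ)
    have hC := hcos0 θ hθ
    have hC1 := (hcos θ hθ).1
    have hC2 := (hcos θ hθ).2
    have hw : √(Real.cos θ ^ 2 * (1 - 4 * a) + a) ^ 2 = Real.cos θ ^ 2 * (1 - 4 * a) + a := by
      refine Real.sq_sqrt ?_
      nlinarith [mul_nonneg (by linarith : 0 ≤ 1 / 3 - a)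
        (by nlinarith : 0 ≤ 4 * Real.cos θ ^ 2 - 1)]
    have hw0 := Real.sqrt_nonneg (Real.cos θ ^ 2 * (1 - 4 * a) + a)
    generalize √(Real.cos θ ^ 2 * (1 - 4 * a) + a) = w at *
    generalize arcScale a θ = v, Real.cos θ = C at *
    have hav : a * v = C - w := by
      have : (a * v - (C - w)) * (C + w) = 0 := by linear_combination a * hv + hw
      rcases mul_eq_zero.1 this with h | h
      · linarith
      · linarith
    rw [hb]
    field_simp
    linear_combination v * hav - hv

/-- At `θ = 0`, where the two conjugate roots meet, `z / c³` takes the end value of the interval. -/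
theorem exists_z_eq_of_c_ne_zero {b c : ℝ} (hc : c ≠ 0) (h2 : b / c ^ 2 ≤ 1 / 3) {y : ℝ}
    (hy : y < (-2 + 9 * (b / c ^ 2) - 2 * √((1 - 3 * (b / c ^ 2)) ^ 3)) / 27) :
    ∃ θ ∈ Set.Ioo (0 : ℝ) (0 + Real.pi / 3),
      -(arcScale (b / c ^ 2) θ - 2 * Real.cos θ) / (-arcScale (b / c ^ 2) θ / c) ^ 3 =
        c ^ 3 * y := by
  have hpi := Real.pi_pos
  generalize b / c ^ 2 = a at *
  have hcos0 : ∀ θ ∈ Set.Icc (0 : ℝ) (Real.pi / 3), 0 < Real.cos θ := fun θ hθ =>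
    Real.cos_pos_of_mem_Ioo ⟨by linarith [hθ.1], by linarith [hθ.2]⟩
  have hcont : ContinuousOn (fun θ => -y * arcScale a θ ^ 3 + (arcScale a θ - 2 * Real.cos θ))
      (Set.Icc 0 (Real.pi / 3)) :=
    have := continuousOn_arcScale a hcos0
    (continuousOn_const.mul (this.pow 3)).add (this.sub (by fun_prop))
  have hend : arcScale a (Real.pi / 3) = 0 := by
    simp only [arcScale, Real.cos_pi_div_three]; norm_num
  have hstart : arcScale a 0 * (1 + √(1 - 3 * a)) = 3 := by
    have := arcScale_mul (a := a) (θ := 0) (by simp)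
    rw [Real.cos_zero] at this
    convert this using 3
    · ring_nf
    · norm_num
  have hw0 := Real.sqrt_nonneg (1 - 3 * a)
  have hw := Real.sq_sqrt (by linarith : 0 ≤ 1 - 3 * a)
  have hw3 : √((1 - 3 * a) ^ 3) = √(1 - 3 * a) ^ 3 := by
    nth_rw 1 [← hw, show (√(1 - 3 * a) ^ 2) ^ 3 = (√(1 - 3 * a) ^ 3) ^ 2 by ring]
    exact Real.sqrt_sq (by positivity)
  obtain ⟨θ, hθ, h0⟩ := intermediate_value_Ioo' (by linarith) hcont
    (show (0 : ℝ) ∈ _ by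
      simp only [hend, Real.cos_pi_div_three, Real.cos_zero]
      refine ⟨by norm_num, ?_⟩
      rw [hw3] at hy
      generalize √(1 - 3 * a) = w at *
      generalize arcScale a 0 = v at *
      have hv : v = 3 / (1 + w) := by rw [eq_div_iff (by positivity)]; exact hstart
      have ha : a = (1 - w ^ 2) / 3 := by linarith
      have : 0 < v ^ 3 := by rw [hv]; positivity
      have key : v ^ 3 * ((-2 + 9 * a - 2 * w ^ 3) / 27) = v - 2 := by
        rw [hv, ha]; field_simp; ring
      nlinarith)
  have hmem : θ ∈ Set.Ioo (0 : ℝ) (0 + Real.pi / 3) := by rwa [zero_add]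
  refine ⟨θ, hmem, ?_⟩
  have hC := half_lt_cos hθ.1.le hθ.2
  have hu : arcScale a θ ≠ 0 :=
    (div_pos (by nlinarith) (by positivity)).ne'
  simp only at h0
  rw [div_eq_iff (pow_ne_zero 3 (div_ne_zero (neg_ne_zero.2 hu) hc))]
  field_simp
  linarith

/-! ### Zeros near parameters with two dominant roots of equal modulus -/

/-- These bounds serve for `x = 2 i n (τ - t)` on the disc of radius `1 / (4 n)` about `t`: there
`exp x` stays bounded, and on the boundary circle it keeps a fixed distance from its value `1` at
the centre. -/
theorem norm_exp_sub_one_bounds {x : ℂ} (hx : ‖x‖ ≤ 1 / 2) :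
    ‖Complex.exp x‖ ≤ 2 ∧ (‖x‖ = 1 / 2 → 1 / 4 ≤ ‖Complex.exp x - 1‖) := by
  have h := Complex.norm_exp_sub_one_sub_id_le (hx.trans (by norm_num))
  constructor
  · have : Complex.exp x = (Complex.exp x - 1 - x) + 1 + x := by ring
    rw [this]
    refine (norm_add₃_le).trans ?_
    rw [norm_one]
    nlinarith [norm_nonneg x]
  · intro he
    have h3 : ‖x‖ ≤ ‖Complex.exp x - 1‖ + ‖Complex.exp x - 1 - x‖ := by
      have := norm_sub_le (Complex.exp x - 1) (Complex.exp x - 1 - x)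
      simpa using this
    rw [he] at h h3
    linarith

theorem sin_combination_eq (n : ℕ) (τ ζ : ℂ) :
    2 * Complex.I * Complex.exp (n * τ * Complex.I) *
      (Complex.sin (n * τ) - ζ * Complex.sin ((n + 1) * τ) + ζ ^ (n + 1) * Complex.sin τ) =
    Complex.exp (2 * n * τ * Complex.I) * (1 - ζ * Complex.exp (τ * Complex.I)) -
      (1 - ζ * Complex.exp (-(τ * Complex.I))) +
      ζ ^ (n + 1) * Complex.exp (n * τ * Complex.I) *
        (Complex.exp (τ * Complex.I) - Complex.exp (-(τ * Complex.I))) := by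
  have hI := Complex.I_sq
  have hW : Complex.exp (n * τ * Complex.I) * Complex.exp (-(n * τ * Complex.I)) = 1 := by
    rw [← Complex.exp_add]; simp
  have e1 : Complex.exp (2 * n * τ * Complex.I) = Complex.exp (n * τ * Complex.I) ^ 2 := by
    rw [← Complex.exp_nat_mul]; congr 1; push_cast; ring
  have e2 : Complex.exp ((n + 1) * τ * Complex.I) =
      Complex.exp (n * τ * Complex.I) * Complex.exp (τ * Complex.I) := by
    rw [← Complex.exp_add]; congr 1; ring
  have e3 : Complex.exp (-((n + 1) * τ * Complex.I)) =
      Complex.exp (-(n * τ * Complex.I)) * Complex.exp (-(τ * Complex.I)) := by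
    rw [← Complex.exp_add]; congr 1; ring
  simp only [Complex.sin, neg_mul, e1, e2, e3]
  generalize Complex.exp (n * τ * Complex.I) = W, Complex.exp (-(n * τ * Complex.I)) = V,
    Complex.exp (τ * Complex.I) = w, Complex.exp (-(τ * Complex.I)) = v at *
  linear_combination (W * (V - W) - ζ * W * (V * v - W * w) + ζ ^ (n + 1) * W * (v - w)) * hI -
    (1 - ζ * v) * hW

/-- If the third root stays strictly smaller than the two equimodular ones at `θ₀`, then for large
`n` the combination of sines from the closed form is, up to a nonvanishing factor, a small
perturbation of `exp (2 i n τ) A - B` with `A, B ≠ 0`. On a disc of radius `1 / (4 n)` about a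
suitable zero of the latter the perturbation cannot remove the zero, by the quantitative open
mapping theorem. -/
theorem exists_sin_combination_eq_zero {θ₀ ε : ℝ} (hε : 0 < ε) {ζ : ℂ → ℂ}
    (hd : DifferentiableOn ℂ ζ (Metric.ball (θ₀ : ℂ) ε)) (hζ : ‖ζ θ₀‖ < 1) :
    ∃ n : ℕ, ∃ τ ∈ Metric.ball (θ₀ : ℂ) ε, ∃ τ' ∈ Metric.ball (θ₀ : ℂ) ε,
      Complex.sin ((n + 1) * τ) - ζ τ * Complex.sin ((n + 2) * τ) +
        ζ τ ^ (n + 2) * Complex.sin τ = 0 ∧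
      Complex.sin ((n + 1) * τ') - ζ τ' * Complex.sin ((n + 2) * τ') +
        ζ τ' ^ (n + 2) * Complex.sin τ' ≠ 0 := by
  set P : ℂ → ℂ := fun τ => 1 - ζ τ * Complex.exp (τ * Complex.I) with hP
  set Q : ℂ → ℂ := fun τ => 1 - ζ τ * Complex.exp (-(τ * Complex.I)) with hQ
  set R : ℂ → ℂ := fun τ => Complex.exp (τ * Complex.I) - Complex.exp (-(τ * Complex.I)) with hR
  set g : ℕ → ℂ → ℂ := fun n τ => Complex.exp (2 * n * τ * Complex.I) * P τ - Q τ +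
    ζ τ ^ (n + 1) * Complex.exp (n * τ * Complex.I) * R τ with hg
  have hPd : DifferentiableOn ℂ P (Metric.ball (θ₀ : ℂ) ε) :=
    (differentiableOn_const 1).sub (hd.mul (by fun_prop))
  have hQd : DifferentiableOn ℂ Q (Metric.ball (θ₀ : ℂ) ε) :=
    (differentiableOn_const 1).sub (hd.mul (by fun_prop))
  have hRd : DifferentiableOn ℂ R (Metric.ball (θ₀ : ℂ) ε) := by fun_prop
  have hgd : ∀ n, DifferentiableOn ℂ (g n) (Metric.ball (θ₀ : ℂ) ε) := fun n =>
    ((DifferentiableOn.mul (by fun_prop) hPd).sub hQd).add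
      (((hd.pow (n + 1)).mul (by fun_prop)).mul hRd)
  have hmem : Metric.ball (θ₀ : ℂ) ε ∈ nhds (θ₀ : ℂ) := Metric.ball_mem_nhds _ hε
  have hne1 : ∀ x : ℂ, ‖x‖ = 1 → 1 - ζ θ₀ * x ≠ 0 := by
    intro x hx h
    have : ‖ζ θ₀ * x‖ = 1 := by rw [← sub_eq_zero.1 h, norm_one]
    rw [norm_mul, hx, mul_one] at this
    exact hζ.ne this
  have hA : P θ₀ ≠ 0 := hne1 _ (Complex.norm_exp_ofReal_mul_I θ₀)
  have hB : Q θ₀ ≠ 0 := by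
    refine hne1 _ ?_
    have := Complex.norm_exp_ofReal_mul_I (-θ₀)
    simpa using this
  obtain ⟨A, hAP⟩ : ∃ A, P θ₀ = A := ⟨_, rfl⟩
  obtain ⟨B, hBQ⟩ : ∃ B, Q θ₀ = B := ⟨_, rfl⟩
  rw [hAP] at hA
  rw [hBQ] at hB
  have hBpos : 0 < ‖B‖ := norm_pos_iff.2 hB
  obtain ⟨q, hq⟩ : ∃ q, q = B / A := ⟨_, rfl⟩
  have hq0 : q ≠ 0 := hq ▸ div_ne_zero hB hA
  obtain ⟨l, hl⟩ : ∃ l : ℂ, Complex.exp (2 * l * Complex.I) = q := by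
    refine ⟨Complex.log q / (2 * Complex.I), ?_⟩
    have : 2 * (Complex.log q / (2 * Complex.I)) * Complex.I = Complex.log q := by
      field_simp
    rw [this, Complex.exp_log hq0]
  obtain ⟨ρ, hρ1, hρ2⟩ := exists_between hζ
  have hρ0 : 0 ≤ ρ := (norm_nonneg _).trans hρ1.le
  -- a neighbourhood of `θ₀` on which the coefficients are nearly constant
  have ev : ∀ᶠ τ in nhds (θ₀ : ℂ), ‖q‖ * 2 * ‖P τ - A‖ < ‖B‖ / 100 ∧ ‖Q τ - B‖ < ‖B‖ / 100 ∧
      ‖ζ τ‖ < ρ ∧ ‖R τ‖ < ‖R θ₀‖ + 1 := by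
    have cP := (hPd.differentiableAt hmem).continuousAt
    have cQ := (hQd.differentiableAt hmem).continuousAt
    have cZ := (hd.differentiableAt hmem).continuousAt
    have cR := (hRd.differentiableAt hmem).continuousAt
    refine Filter.Eventually.and ?_ (Filter.Eventually.and ?_ (Filter.Eventually.and ?_ ?_))
    · have : ContinuousAt (fun τ => ‖q‖ * 2 * ‖P τ - A‖) (θ₀ : ℂ) :=
        continuousAt_const.mul (cP.sub continuousAt_const).norm
      exact this.eventually_lt continuousAt_const (by
        simp only [hAP, sub_self, norm_zero, mul_zero]; positivity)
    · have : ContinuousAt (fun τ => ‖Q τ - B‖) (θ₀ : ℂ) := (cQ.sub continuousAt_const).norm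
      exact this.eventually_lt continuousAt_const (by
        simp only [hBQ, sub_self, norm_zero]; positivity)
    · exact cZ.norm.eventually_lt continuousAt_const hρ1
    · exact cR.norm.eventually_lt continuousAt_const (by simp)
  obtain ⟨δ, hδ, hball⟩ := Metric.mem_nhds_iff.1 (Filter.inter_mem hmem ev)
  have evn : ∀ᶠ n : ℕ in Filter.atTop, (‖l‖ + Real.pi + 1) / n < δ ∧
      ρ ^ n * ((1 + 2 * ‖q‖) * (‖R θ₀‖ + 1)) < ‖B‖ / 100 := by
    refine Filter.Eventually.and ?_ ?_
    · exact (tendsto_const_div_atTop_nhds_zero_nat _).eventually (gt_mem_nhds hδ)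
    · have := (tendsto_pow_atTop_nhds_zero_of_lt_one hρ0 hρ2).mul_const
        ((1 + 2 * ‖q‖) * (‖R θ₀‖ + 1))
      rw [zero_mul] at this
      exact this.eventually (gt_mem_nhds (by positivity))
  obtain ⟨N, hN⟩ := Filter.eventually_atTop.1 evn
  obtain ⟨hn1, hn2⟩ := hN (N + 1) (by omega)
  set n := N + 1 with hn
  have hn0 : (0 : ℝ) < n := by rw [hn]; positivity
  have hnC : (n : ℂ) ≠ 0 := by exact_mod_cast hn0.ne'
  -- the zero of `exp (2 i n τ) A - B` nearest to `θ₀`, up to one period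
  set k : ℤ := ⌊n * θ₀ / Real.pi⌋ with hk
  set t : ℂ := (l + k * Real.pi) / n with ht
  have htθ : ‖t - θ₀‖ ≤ (‖l‖ + Real.pi) / n := by
    have e : t - θ₀ = (l + ((k * Real.pi - n * θ₀ : ℝ) : ℂ)) / n := by
      rw [ht]; push_cast; field_simp; ring
    rw [e, norm_div, Complex.norm_natCast]
    gcongr
    refine (norm_add_le _ _).trans ?_
    gcongr
    rw [Complex.norm_real, Real.norm_eq_abs, abs_le]
    have f1 := Int.floor_le (n * θ₀ / Real.pi)
    have f2 := Int.lt_floor_add_one (n * θ₀ / Real.pi)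
    rw [← hk] at f1 f2
    rw [le_div_iff₀ Real.pi_pos] at f1
    rw [div_lt_iff₀ Real.pi_pos] at f2
    constructor <;> linarith [Real.pi_pos]
  set r : ℝ := 1 / (4 * n) with hr
  have hr0 : 0 < r := by positivity
  have hin : ∀ τ ∈ Metric.closedBall t r, τ ∈ Metric.ball (θ₀ : ℂ) δ := by
    intro τ hτ
    rw [Metric.mem_closedBall, dist_eq_norm] at hτ
    rw [Metric.mem_ball, dist_eq_norm]
    have e : τ - θ₀ = (τ - t) + (t - θ₀) := by ring
    rw [e]
    refine ((norm_add_le _ _).trans (add_le_add hτ htθ)).trans_lt (lt_of_le_of_lt ?_ hn1)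
    rw [hr, div_add_div _ _ (by positivity) (by positivity),
      div_le_div_iff₀ (by positivity) (by positivity)]
    nlinarith [sq_nonneg (n : ℝ), mul_pos hn0 hn0]
  set x : ℂ → ℂ := fun τ => 2 * n * (τ - t) * Complex.I with hx
  have hxn : ∀ τ, ‖x τ‖ = 2 * n * ‖τ - t‖ := fun τ => by
    simp [hx]
  have hexp : ∀ τ, Complex.exp (2 * n * τ * Complex.I) = Complex.exp (x τ) * q := by
    intro τ
    have e : 2 * n * τ * Complex.I =
        x τ + (2 * l * Complex.I + k * (2 * Real.pi * Complex.I)) := by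
      rw [hx, ht]; field_simp; ring
    rw [e, Complex.exp_add, Complex.exp_add, Complex.exp_int_mul_two_pi_mul_I, mul_one, hl]
  have herr : ∀ τ ∈ Metric.closedBall t r, ‖g n τ - B * (Complex.exp (x τ) - 1)‖ ≤
      3 * (‖B‖ / 100) := by
    intro τ hτ
    obtain ⟨-, b1, b2, b3, b4⟩ := hball (hin τ hτ)
    rw [Metric.mem_closedBall, dist_eq_norm] at hτ
    have hx2 : ‖x τ‖ ≤ 1 / 2 := by
      rw [hxn]
      calc 2 * n * ‖τ - t‖ ≤ 2 * n * r := by gcongr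
        _ = 1 / 2 := by rw [hr]; field_simp; norm_num
    have hE := (norm_exp_sub_one_bounds hx2).1
    have e : g n τ - B * (Complex.exp (x τ) - 1) =
        q * Complex.exp (x τ) * (P τ - A) + -(Q τ - B) +
          ζ τ ^ (n + 1) * Complex.exp (n * τ * Complex.I) * R τ := by
      have : q * A = B := by rw [hq, div_mul_cancel₀ _ hA]
      simp only [hg]
      rw [hexp]
      linear_combination Complex.exp (x τ) * this
    have hW : ‖Complex.exp (n * τ * Complex.I)‖ ≤ 1 + 2 * ‖q‖ := by
      have h2 : ‖Complex.exp (n * τ * Complex.I)‖ ^ 2 ≤ 2 * ‖q‖ := by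
        rw [← norm_pow, ← Complex.exp_nat_mul,
          show ((2 : ℕ) : ℂ) * (n * τ * Complex.I) = 2 * n * τ * Complex.I by push_cast; ring,
          hexp, norm_mul]
        gcongr
      nlinarith [sq_nonneg (‖Complex.exp (n * τ * Complex.I)‖ - 1)]
    rw [e]
    refine norm_add₃_le.trans ?_
    have t1 : ‖q * Complex.exp (x τ) * (P τ - A)‖ ≤ ‖B‖ / 100 := by
      rw [norm_mul, norm_mul]
      refine le_trans ?_ b1.le
      gcongr
    have t2 : ‖-(Q τ - B)‖ ≤ ‖B‖ / 100 := by rw [norm_neg]; exact b2.le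
    have t3 : ‖ζ τ ^ (n + 1) * Complex.exp (n * τ * Complex.I) * R τ‖ ≤ ‖B‖ / 100 := by
      rw [norm_mul, norm_mul, norm_pow, mul_assoc]
      refine le_trans ?_ hn2.le
      have : ‖ζ τ‖ ^ (n + 1) ≤ ρ ^ n :=
        (pow_le_pow_left₀ (norm_nonneg _) b3.le _).trans
          (pow_le_pow_of_le_one hρ0 hρ2.le (by omega))
      gcongr
    linarith
  have hcenter : ‖g n t‖ ≤ 3 * (‖B‖ / 100) := by
    have := herr t (Metric.mem_closedBall_self hr0.le)
    simpa [hx] using this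
  have hsphere : ∀ τ ∈ Metric.sphere t r, ‖B‖ / 4 - 3 * (‖B‖ / 100) ≤ ‖g n τ‖ := by
    intro τ hτ
    have h1 := herr τ (Metric.sphere_subset_closedBall hτ)
    rw [Metric.mem_sphere, dist_eq_norm] at hτ
    have hx2 : ‖x τ‖ = 1 / 2 := by rw [hxn, hτ, hr]; field_simp; norm_num
    have h2 := (norm_exp_sub_one_bounds hx2.le).2 hx2
    have h3 : ‖B * (Complex.exp (x τ) - 1)‖ ≤
        ‖g n τ‖ + ‖g n τ - B * (Complex.exp (x τ) - 1)‖ := by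
      have := norm_sub_le (g n τ) (g n τ - B * (Complex.exp (x τ) - 1))
      simpa using this
    rw [norm_mul] at h3
    nlinarith
  have hsub : Metric.closedBall t r ⊆ Metric.ball (θ₀ : ℂ) ε := fun τ hτ => (hball (hin τ hτ)).1
  have hpt : t + r ∈ Metric.sphere t r := by
    rw [Metric.mem_sphere, dist_eq_norm]; simp [hr0.le]
  have hdiff : ∀ τ ∈ Metric.sphere t r, ‖B‖ / 10 ≤ ‖g n τ - g n t‖ := by
    intro τ hτ
    have := norm_sub_norm_le (g n τ) (g n t)
    linarith [hsphere τ hτ]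
  have hfreq : ∃ᶠ τ in nhds t, g n τ ≠ g n t := by
    intro hcon
    have hcon : g n =ᶠ[nhds t] fun _ => g n t := by
      filter_upwards [hcon] with τ hτ
      exact not_not.1 hτ
    have heq := ((hgd n).analyticOnNhd Metric.isOpen_ball).eqOn_of_preconnected_of_eventuallyEq
      analyticOnNhd_const (convex_ball _ _).isPreconnected
      (hsub (Metric.mem_closedBall_self hr0.le)) hcon
    have h1 := heq (hsub (Metric.sphere_subset_closedBall hpt))
    have h2 := hdiff _ hpt
    simp only at h1
    rw [h1, sub_self, norm_zero] at h2
    linarith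
  have hcl : DiffContOnCl ℂ (g n) (Metric.ball t r) :=
    ((hgd n).mono (Metric.closure_ball_subset_closedBall.trans hsub)).diffContOnCl
  obtain ⟨τ, hτ, hτ0⟩ := hcl.ball_subset_image_closedBall hr0 hdiff hfreq
    (show (0 : ℂ) ∈ _ by
      rw [Metric.mem_ball, dist_zero_left]; linarith)
  have hpt0 : g n (t + r) ≠ 0 := by
    rw [← norm_pos_iff]; linarith [hsphere _ hpt]
  have hgs : ∀ τ, 2 * Complex.I * Complex.exp (n * τ * Complex.I) *
      (Complex.sin ((N + 1) * τ) - ζ τ * Complex.sin ((N + 2) * τ) +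
        ζ τ ^ (N + 2) * Complex.sin τ) = g n τ := by
    intro τ
    have := sin_combination_eq n τ (ζ τ)
    rw [show ((n : ℂ) + 1) = N + 2 by rw [hn]; push_cast; ring,
      show n + 1 = N + 2 from rfl] at this
    simp only [hg, hP, hQ, hR]
    rw [show n + 1 = N + 2 from rfl, ← this, hn]
    push_cast
    ring
  refine ⟨N, τ, hsub hτ, t + r, hsub (Metric.sphere_subset_closedBall hpt), ?_, ?_⟩
  · have := (hgs τ).trans hτ0
    simpa using this
  · intro h0
    have := hgs (t + r)
    rw [h0, mul_zero] at this
    exact hpt0 this.symm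

/-! ### Non-real zeros outside the admissible range -/

/-- A pair of equimodular roots `exp (± i θ) / u` with `k = cos² θ` and non-real `u` exists if the
discriminant `k c² - b (4 k - 1)` is negative; it dominates the third root if
`4 k - c² / b = |ζ|²` is less than `1`. -/
theorem exists_cos_sq {b c : ℝ}
    (h : ¬((c = 0 ∧ 0 ≤ b) ∨ (c ≠ 0 ∧ -1 ≤ b / c ^ 2 ∧ b / c ^ 2 ≤ 1 / 3))) :
    b ≠ 0 ∧ ∃ k : ℝ, 0 < k ∧ k < 1 ∧ k * c ^ 2 < b * (4 * k - 1) ∧ 4 * k - c ^ 2 / b < 1 := by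
  have neg : b < 0 → c ^ 2 < -b →
      b ≠ 0 ∧ ∃ k : ℝ, 0 < k ∧ k < 1 ∧ k * c ^ 2 < b * (4 * k - 1) ∧ 4 * k - c ^ 2 / b < 1 := by
    intro hb hcb
    have hd1 : -1 < c ^ 2 / b := by rw [lt_div_iff_of_neg hb]; linarith
    have hd0 : c ^ 2 / b ≤ 0 := div_nonpos_of_nonneg_of_nonpos (sq_nonneg c) hb.le
    have hbd : b * (c ^ 2 / b) = c ^ 2 := mul_div_cancel₀ _ hb.ne
    refine ⟨hb.ne, (1 + c ^ 2 / b) / 8, by linarith, by linarith, ?_, by linarith⟩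
    nlinarith [sq_nonneg c]
  by_cases hc : c = 0
  · subst hc
    have hb : b < 0 := by
      by_contra hb
      exact h (Or.inl ⟨rfl, not_lt.1 hb⟩)
    exact neg hb (by linarith)
  · have hc2 : 0 < c ^ 2 := by positivity
    by_cases h1 : -1 ≤ b / c ^ 2
    · have h2 : 1 / 3 < b / c ^ 2 := by
        by_contra h2
        exact h (Or.inr ⟨hc, h1, not_lt.1 h2⟩)
      rw [lt_div_iff₀ hc2] at h2
      have hb : 0 < b := by linarith
      have hd : 0 < 5 * b - c ^ 2 := by linarith
      -- `4 k - 1` is the mediant of its two bounds `c² / (4 b - c²)` and `c² / b`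
      obtain ⟨D, hD⟩ : ∃ D, D = 2 * c ^ 2 / (5 * b - c ^ 2) := ⟨_, rfl⟩
      have hD0 : 0 < D := hD ▸ by positivity
      have hD3 : D < 3 := by rw [hD, div_lt_iff₀ hd]; linarith
      have hDd : D < c ^ 2 / b := by rw [hD, div_lt_div_iff₀ hd hb]; nlinarith
      rw [eq_div_iff hd.ne'] at hD
      refine ⟨hb.ne', (1 + D) / 4, by linarith, by linarith, ?_, by linarith⟩
      have : 0 < (b * D - (1 + D) / 4 * c ^ 2) * (5 * b - c ^ 2) := by
        have e : (b * D - (1 + D) / 4 * c ^ 2) * (5 * b - c ^ 2) =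
            c ^ 2 * (3 * b - c ^ 2) / 4 := by
          linear_combination (b - c ^ 2 / 4) * hD
        rw [e]
        exact div_pos (mul_pos hc2 (by linarith)) (by norm_num)
      linarith [pos_of_mul_pos_left this hd.le]
    · rw [not_le, div_lt_iff₀ hc2] at h1
      exact neg (by linarith) (by linarith)

/-- By the quadratic equation for `u`, the number `(4 C² - 1)² z` is an affine function of `1 / u`
with real coefficients and nonzero slope `2 C (c² - b (4 C² - 1))`, hence `z` is not real. -/
theorem im_ne_zero_of_quadratic {b c C : ℝ} {u z : ℂ} (hC : C ≠ 0) (hu : u.im ≠ 0)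
    (hquad : b * u ^ 2 + 2 * c * u * C + (4 * C ^ 2 - 1) = 0)
    (hz : z * u ^ 3 = c * u + 2 * C) (hne : c ^ 2 ≠ b * (4 * C ^ 2 - 1)) :
    z.im ≠ 0 := by
  intro hzim
  have hu0 : u ≠ 0 := fun h => hu (by simp [h])
  obtain ⟨x, rfl⟩ : ∃ x : ℝ, (x : ℂ) = z := ⟨z.re, Complex.ext (by simp) (by simp [hzim])⟩
  have key : ((4 * C ^ 2 - 1) ^ 2 * x - c * b : ℂ) * u =
      2 * C * (c ^ 2 - b * (4 * C ^ 2 - 1)) := by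
    have : u ^ 2 * (((4 * C ^ 2 - 1) ^ 2 * x - c * b : ℂ) * u -
        2 * C * (c ^ 2 - b * (4 * C ^ 2 - 1))) = 0 := by
      linear_combination (4 * C ^ 2 - 1 : ℂ) ^ 2 * hz +
        (2 * C * (4 * C ^ 2 - 1) - c * u) * hquad
    rcases mul_eq_zero.1 this with h | h
    · exact absurd h (pow_ne_zero 2 hu0)
    · exact sub_eq_zero.1 h
  have him := congrArg Complex.im key
  have hre := congrArg Complex.re key
  have e1 : ((4 * C ^ 2 - 1) ^ 2 * x - c * b : ℂ) = (((4 * C ^ 2 - 1) ^ 2 * x - c * b : ℝ) : ℂ) := by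
    push_cast; ring
  have e2 : (2 * C * (c ^ 2 - b * (4 * C ^ 2 - 1)) : ℂ) =
      ((2 * C * (c ^ 2 - b * (4 * C ^ 2 - 1)) : ℝ) : ℂ) := by push_cast; ring
  rw [e1, e2, Complex.im_ofReal_mul, Complex.ofReal_im] at him
  rw [e1, e2, Complex.re_ofReal_mul, Complex.ofReal_re] at hre
  rcases mul_eq_zero.1 him with h | h
  · rw [h, zero_mul] at hre
    rcases mul_eq_zero.1 hre.symm with h' | h'
    · exact hC (by linarith)
    · exact hne (by linarith)
  · exact hu h

theorem exists_nonreal_root {b c : ℝ} {H : ℕ → ℝ[X]}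
    (h0 : H 0 = 1) (h1 : H 1 = C (-c)) (h2 : H 2 = C (-b + c ^ 2))
    (hrec : ∀ m, H (m + 3) + C c * H (m + 2) + C b * H (m + 1) + X * H m = 0)
    {k : ℝ} (hb : b ≠ 0) (hk0 : 0 < k) (hk1 : k < 1) (hdisc : k * c ^ 2 < b * (4 * k - 1))
    (hdom : 4 * k - c ^ 2 / b < 1) :
    ∃ m, ∃ z ∈ (H m).rootSet ℂ, z.im ≠ 0 := by
  have hbC : (b : ℂ) ≠ 0 := by exact_mod_cast hb
  obtain ⟨θ₀, hcos⟩ : ∃ θ₀, Real.cos θ₀ = √k :=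
    ⟨Real.arccos √k, Real.cos_arccos (by linarith [Real.sqrt_nonneg k])
      (Real.sqrt_le_one.2 hk1.le)⟩
  have hcosk : Real.cos θ₀ ^ 2 = k := by rw [hcos, Real.sq_sqrt hk0.le]
  have hC0 : Real.cos θ₀ ≠ 0 := by rw [hcos]; exact (Real.sqrt_pos.2 hk0).ne'
  have hS0 : Real.sin θ₀ ≠ 0 := fun h => by
    have := Real.sin_sq_add_cos_sq θ₀
    rw [h, hcosk] at this
    linarith
  -- the solution of `b u² + 2 c u cos τ + 4 cos² τ - 1 = 0` that is non-real at `θ₀`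
  set d : ℂ → ℂ := fun τ => b * (4 * Complex.cos τ ^ 2 - 1) - c ^ 2 * Complex.cos τ ^ 2 with hd
  set u : ℂ → ℂ := fun τ =>
    (-(c * Complex.cos τ) + Complex.I * d τ ^ (1 / 2 : ℂ)) / b with hu
  set ζ : ℂ → ℂ := fun τ => -(c * u τ) - 2 * Complex.cos τ with hζ
  set z : ℂ → ℂ := fun τ => -ζ τ / u τ ^ 3 with hz
  have hd0 : d θ₀ = ((b * (4 * k - 1) - k * c ^ 2 : ℝ) : ℂ) := by
    rw [← hcosk]; simp only [hd]; push_cast; ring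
  have hsqrt : ∀ τ, (d τ ^ (1 / 2 : ℂ)) ^ 2 = d τ := fun τ => by
    rw [← Complex.cpow_nat_mul]; norm_num
  have hquad : ∀ τ, b * u τ ^ 2 + 2 * c * u τ * Complex.cos τ + (4 * Complex.cos τ ^ 2 - 1) = 0 := by
    intro τ
    have h := hsqrt τ
    simp only [hu]
    field_simp
    linear_combination (d τ ^ (1 / 2 : ℂ)) ^ 2 * Complex.I_sq - h
  have hslit : ∀ᶠ τ in nhds (θ₀ : ℂ), d τ ∈ Complex.slitPlane := by
    have hdc : ContinuousAt d θ₀ := by fun_prop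
    refine hdc.eventually_mem (Complex.isOpen_slitPlane.mem_nhds ?_)
    rw [hd0, Complex.ofReal_mem_slitPlane]
    linarith
  have hud : ∀ τ, d τ ∈ Complex.slitPlane → DifferentiableAt ℂ u τ := by
    intro τ hτ
    have : DifferentiableAt ℂ d τ := by fun_prop
    exact ((by fun_prop : DifferentiableAt ℂ (fun τ => -(c * Complex.cos τ)) τ).add
      ((differentiableAt_const _).mul (this.cpow_const hτ))).div_const _
  have hζd : ∀ τ, d τ ∈ Complex.slitPlane → DifferentiableAt ℂ ζ τ := fun τ hτ =>
    (((hud τ hτ).const_mul _).neg).sub (by fun_prop)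
  -- values at `θ₀`
  set w := √(b * (4 * k - 1) - k * c ^ 2) with hw
  have hwpos : 0 < w := Real.sqrt_pos.2 (by linarith)
  have hw2 : w ^ 2 = b * (4 * k - 1) - k * c ^ 2 := Real.sq_sqrt (by linarith)
  have hu0 : u θ₀ = (-(c * Real.cos θ₀) / b : ℝ) + (w / b : ℝ) * Complex.I := by
    have : (d θ₀) ^ (1 / 2 : ℂ) = (w : ℂ) := by
      rw [hd0, hw, Real.sqrt_eq_rpow, Complex.ofReal_cpow (by linarith)]
      norm_num
    simp only [hu]
    rw [this]
    push_cast
    field_simp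
  have hure : (u θ₀).re = -(c * Real.cos θ₀) / b := by
    rw [hu0]; simp [Complex.cos_ofReal_re]
  have huim : (u θ₀).im = w / b := by rw [hu0]; simp
  have huim0 : (u θ₀).im ≠ 0 := by rw [huim]; exact div_ne_zero hwpos.ne' hb
  have hun0 : u θ₀ ≠ 0 := fun h => huim0 (by rw [h, Complex.zero_im])
  have hζnorm : ‖ζ θ₀‖ < 1 := by
    have hre : (ζ θ₀).re = -(c * (u θ₀).re) - 2 * Real.cos θ₀ := by
      simp only [hζ]
      rw [← Complex.ofReal_cos]
      simp [Complex.cos_ofReal_re]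
    have him : (ζ θ₀).im = -(c * (u θ₀).im) := by
      simp only [hζ]
      rw [← Complex.ofReal_cos]
      simp [Complex.cos_ofReal_re]
    have hn : ‖ζ θ₀‖ ^ 2 = 4 * k - c ^ 2 / b := by
      rw [Complex.sq_norm, Complex.normSq_apply, hre, him, hure, huim]
      field_simp
      linear_combination (c ^ 4 - 4 * b * c ^ 2 + 4 * b ^ 2) * hcosk + c ^ 2 * hw2
    nlinarith [norm_nonneg (ζ θ₀)]
  have hzim : (z θ₀).im ≠ 0 := by
    refine im_ne_zero_of_quadratic (b := b) (c := c) (C := Real.cos θ₀) (u := u θ₀) hC0 huim0 ?_ ?_ ?_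
    · rw [Complex.ofReal_cos]; exact hquad θ₀
    · rw [Complex.ofReal_cos]
      simp only [hz]
      rw [div_mul_cancel₀ _ (pow_ne_zero 3 hun0)]
      simp only [hζ]; ring
    · rw [hcosk]
      intro h
      rw [h, mul_div_cancel_left₀ _ hb] at hdom
      linarith
  have hucont := (hud θ₀ hslit.self_of_nhds).continuousAt
  have hζcont := (hζd θ₀ hslit.self_of_nhds).continuousAt
  have hzcont : ContinuousAt z θ₀ := hζcont.neg.div (hucont.pow 3) (pow_ne_zero 3 hun0)
  set K : ℂ → ℂ := fun τ => Complex.sin τ * (1 - 2 * ζ τ * Complex.cos τ + ζ τ ^ 2) with hK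
  have hKcont : ContinuousAt K θ₀ := by
    refine ContinuousAt.mul (by fun_prop) ?_
    exact (continuousAt_const.sub ((continuousAt_const.mul hζcont).mul (by fun_prop))).add
      (hζcont.pow 2)
  have hK0 : K θ₀ ≠ 0 := by
    refine mul_ne_zero (by rw [← Complex.ofReal_sin]; exact_mod_cast hS0) fun h => ?_
    have hprod : (ζ θ₀ - Complex.exp (θ₀ * Complex.I)) *
        (ζ θ₀ - Complex.exp ((-θ₀ : ℝ) * Complex.I)) = 0 := by
      rw [Complex.exp_mul_I, Complex.exp_mul_I, Complex.ofReal_neg, Complex.cos_neg,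
        Complex.sin_neg]
      linear_combination h + Complex.sin_sq_add_cos_sq (θ₀ : ℂ) -
        Complex.sin (θ₀ : ℂ) ^ 2 * Complex.I_sq
    rcases mul_eq_zero.1 hprod with h | h <;>
    · rw [sub_eq_zero.1 h, Complex.norm_exp_ofReal_mul_I] at hζnorm
      exact hζnorm.false
  have ev : ∀ᶠ τ in nhds (θ₀ : ℂ), d τ ∈ Complex.slitPlane ∧ u τ ≠ 0 ∧ K τ ≠ 0 ∧ (z τ).im ≠ 0 :=
    hslit.and ((hucont.eventually_ne hun0).and ((hKcont.eventually_ne hK0).and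
      ((Complex.continuous_im.continuousAt.comp hzcont).eventually_ne hzim)))
  obtain ⟨ε, hε, hball⟩ := Metric.mem_nhds_iff.1 ev
  obtain ⟨m, τ, hτ, τ', hτ', e, e'⟩ := exists_sin_combination_eq_zero hε (ζ := ζ)
    (fun τ hτ => (hζd τ (hball hτ).1).differentiableWithinAt) hζnorm
  have formula : ∀ τ ∈ Metric.ball (θ₀ : ℂ) ε, u τ ^ m * K τ * aeval (z τ) (H m) =
      Complex.sin ((m + 1) * τ) - ζ τ * Complex.sin ((m + 2) * τ) +
        ζ τ ^ (m + 2) * Complex.sin τ := by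
    intro τ hτ
    obtain ⟨-, hun, -, -⟩ := hball hτ
    have := closed_form (b := (b : ℂ)) (c := c) (u := u τ) (ζ := ζ τ)
      (h := fun m => aeval (z τ) (H m)) (z := z τ)
      (s := fun n : ℕ => Complex.sin (n * τ)) (C := Complex.cos τ) (by simp [h0]) (by simp [h1])
      (by rw [h2, aeval_C]; simp)
      (fun m => by simpa using congrArg (aeval (z τ)) (hrec m)) (by simp)
      (fun n => by
        have e1 : ((n + 2 : ℕ) : ℂ) * τ = (n + 1 : ℕ) * τ + τ := by push_cast; ring
        have e2 : (n : ℂ) * τ = (n + 1 : ℕ) * τ - τ := by push_cast; ring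
        simp only [e1, e2, Complex.sin_add, Complex.sin_sub]; ring)
      (by simp only [hζ]; ring)
      (by simp only [hζ]; linear_combination hquad τ)
      (div_mul_cancel₀ _ (pow_ne_zero 3 hun)) m
    simpa using this
  obtain ⟨-, hun, hKτ, hzτ⟩ := hball hτ
  refine ⟨m, z τ, ?_, hzτ⟩
  rw [mem_rootSet]
  constructor
  · intro hH
    have := formula τ' hτ'
    rw [hH, map_zero, mul_zero] at this
    exact e' this.symm
  · have := (formula τ hτ).trans e
    rcases mul_eq_zero.1 this with h | h
    · exact absurd h (mul_ne_zero (pow_ne_zero m hun) hKτ)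
    · exact h

/-! ### The monomial case and the conclusion -/

/-- For `b = c = 0` every `H m` is zero or a power of `-X`. -/
theorem eq_zero_of_b_c_eq_zero {H : ℕ → ℝ[X]}
    (h0 : H 0 = 1) (h1 : H 1 = 0) (h2 : H 2 = 0)
    (hrec : ∀ m, H (m + 3) + X * H m = 0) (m : ℕ) {z : ℂ} (hz : z ∈ (H m).rootSet ℂ) : z = 0 := by
  induction m using Nat.strong_induction_on with
  | _ m ih =>
    match m, ih, hz with
    | 0, _, hz => simp [h0] at hz
    | 1, _, hz => simp [h1] at hz
    | 2, _, hz => simp [h2] at hz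
    | m + 3, ih, hz =>
      have e : H (m + 3) = -(X * H m) := by linear_combination hrec m
      rw [e, mem_rootSet] at hz
      obtain ⟨hne, hz⟩ := hz
      have hne' : H m ≠ 0 := fun h => hne (by simp [h])
      rw [map_neg, neg_eq_zero, map_mul, aeval_X] at hz
      rcases mul_eq_zero.1 hz with h | h
      · exact h
      · exact ih m (by omega) (mem_rootSet.2 ⟨hne', h⟩)

/-- For a real polynomial `p`, `p.rootSet ℂ` is the set of its complex zeros if `p ≠ 0`, and it is
empty if `p = 0`: the zeros of the constant zero polynomial count as real, and zero polynomials
among the `H m` contribute nothing to the union of the zero sets. -/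
theorem theorem1 (b c : ℝ) (H : ℕ → ℝ[X])
    (h0 : H 0 = 1) (h1 : H 1 = C (-c)) (h2 : H 2 = C (-b + c ^ 2))
    (hrec : ∀ m, 3 ≤ m →
      H m + C c * H (m - 1) + C b * H (m - 2) + X * H (m - 3) = 0) :
    ((∀ m, ∀ z ∈ (H m).rootSet ℂ, z.im = 0) ↔
      (c = 0 ∧ 0 ≤ b) ∨ (c ≠ 0 ∧ -1 ≤ b / c ^ 2 ∧ b / c ^ 2 ≤ 1 / 3)) ∧
    (c = 0 → 0 < b → Dense {x : ℝ | (x : ℂ) ∈ ⋃ m, (H m).rootSet ℂ}) ∧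
    (c ≠ 0 → -1 ≤ b / c ^ 2 → b / c ^ 2 ≤ 1 / 3 →
      (fun x : ℝ => c ^ 3 * x) ''
          Set.Iic ((-2 + 9 * (b / c ^ 2) - 2 * √((1 - 3 * (b / c ^ 2)) ^ 3)) / 27) ⊆
        closure {x : ℝ | (x : ℂ) ∈ ⋃ m, (H m).rootSet ℂ}) := by
  have hrec' : ∀ m, H (m + 3) + C c * H (m + 2) + C b * H (m + 1) + X * H m = 0 :=
    fun m => hrec (m + 3) (by omega)
  refine ⟨⟨fun hreal => ?_, ?_⟩, ?_, ?_⟩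
  · by_contra hcon
    obtain ⟨hb, k, hk0, hk1, hdisc, hdom⟩ := exists_cos_sq hcon
    obtain ⟨m, z, hz, him⟩ := exists_nonreal_root h0 h1 h2 hrec' hb hk0 hk1 hdisc hdom
    exact him (hreal m z hz)
  · rintro (⟨rfl, hb⟩ | ⟨hc, ha1, ha2⟩) m z hz
    · rcases hb.eq_or_lt with rfl | hb
      · rw [eq_zero_of_b_c_eq_zero h0 (by simpa using h1) (by simpa using h2)
          (fun m => by simpa using hrec' m) m hz, Complex.zero_im]
      · exact (isRootArc_of_c_eq_zero hb).im_eq_zero h0 h1 h2 hrec' m hz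
    · exact (isRootArc_of_c_ne_zero hc ha1 ha2).im_eq_zero h0 h1 h2 hrec' m hz
  · rintro rfl hb y
    obtain ⟨θ, hθ, rfl⟩ := exists_z_eq_of_c_eq_zero hb y
    exact (isRootArc_of_c_eq_zero hb).mem_closure h0 h1 h2 hrec' hθ
  · intro hc ha1 ha2
    -- the arc covers the open half-line, and the closure adds the end point
    rw [← closure_Iio]
    refine (image_closure_subset_closure_image (by fun_prop)).trans
      (closure_minimal ?_ isClosed_closure)
    rintro _ ⟨y, hy, rfl⟩
    obtain ⟨θ, hθ, h⟩ := exists_z_eq_of_c_ne_zero hc ha2 hy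
    beta_reduce
    rw [← h]
    exact (isRootArc_of_c_ne_zero hc ha1 ha2).mem_closure h0 h1 h2 hrec' hθ
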